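/- **Conventions.** A cover of a space is an indexed family of subsets with union the whole space; a map of covers $\{U_\alpha\}_{\alpha\in A}\to\{V_\beta\}_{\beta\in B}$ is a map $\xi:A\to B$ with $U_\alpha\subseteq V_{\xi(\alpha)}$ for all $\alpha$. A tower of covers of $Z$ with resolution $r\in\mathbb R$ is a family $\mathfrak W=\{\mathcal W_\varepsilon\}_{\varepsilon\ge r}$ of finite covers of $Z$ by path connected open sets, with maps of covers $w_{\varepsilon,\varepsilon'}:\mathcal W_\varepsilon\to\mathcal W_{\varepsilon'}$ for $r\le\varepsilon\le\varepsilon'$ such that $w_{\varepsilon,\varepsilon}=\mathrm{id}$ and $w_{\varepsilon',\varepsilon''}\circ w_{\varepsilon,\varepsilon'}=w_{\varepsilon,\varepsilon''}$. If $r>0$, the reindexed tower $\mathrm R_{\log}\mathfrak W$ has resolution $\log r$, covers $\mathcal W_{\exp\varepsilon}$ for $\varepsilon\ge\log r$, and maps $w_{\exp\varepsilon,\exp\varepsilon'}$. Let $c\ge1$ and $s>0$. A tower of covers $\mathfrak W$ of a compact metric space $(Z,d_Z)$ is $(c,s)$-good if (1) its resolution is $s$, and $s\le\operatorname{diam}(Z)$;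 (2) $\operatorname{diam}(W)\le\varepsilon$ for every member $W$ of $\mathcal W_\varepsilon$ and every $\varepsilon\ge s$; (3) every $O\subseteq Z$ with $\operatorname{diam}(O)\ge s$ is contained in some member of $\mathcal W_{c\cdot\operatorname{diam}(O)}$. A map $f:X\to Z$ is well-behaved if $f^{-1}(U)$ has finitely many path components for every path connected open $U\subseteq Z$. For continuous well-behaved $f$ and a cover $\mathcal U=\{U_\alpha\}$ of $Z$, the pullback $f^*(\mathcal U)$ is the cover of $X$ by the path components of the sets $f^{-1}(U_\alpha)$; a map of covers given by $\xi$ pulls back to the map sending a path component of $f^{-1}(U_\alpha)$ to the path component of $f^{-1}(V_{\xi(\alpha)})$ containing it. The multiscale mapper $\mathrm{MM}(\mathfrak W,f)$ is the tower of simplicial complexes formed by the nerves of the pullbacks $f^*(\mathcal W_\varepsilon)$ with the induced simplicial maps. Fix a field; $\mathrm D_k\mathrm{MM}(\mathfrak W,f)$ denotes the persistence diagram of the persistence module $\varepsilon\mapsto \mathrm H_k\big(N(f^*(\mathcal W_\varepsilon))\big)$ (simplicial homology with coefficients in the field, and zero below the resolution), a multiset of points $(b,d)$ with $b<d\le\infty$.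 The bottleneck distance is the infimum of the $r\in[0,\infty]$ for which there is a partial matching of the points of the two diagrams such that matched points are at $\ell^\infty$-distance at most $r$ and unmatched points are at $\ell^\infty$-distance at most $r$ from the diagonal. **Statement.** Let $\mathfrak W$ be a $(c,s)$-good tower of covers of a compact connected metric space $(Z,d_Z)$, let $X$ be a topological space, and let $f,g:X\to Z$ be well-behaved continuous maps such that $\delta=\sup_{x\in X}d_Z(f(x),g(x))$ (with $X$ non-empty). Then for every field of coefficients and every $k\in\mathbb N$ the bottleneck distance between $\mathrm D_k\mathrm{MM}(\mathrm R_{\log}\mathfrak W,f)$ and $\mathrm D_k\mathrm{MM}(\mathrm R_{\log}\mathfrak W,g)$ is at most $$\log\big(2c\max(s,\delta)+c\big)+\max\Big(0,\log\frac1s\Big).$$ -/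

import Mathlib

open CategoryTheory Topology
open scoped ENNReal

universe u v w t

/-! ### Covers and maps of covers -/

/-- A cover of `X`: an indexed family of subsets whose union is `X`. -/
structure Cover (X : Type u) where
  /-- the index set -/
  ι : Type v
  /-- the members of the cover -/
  set : ι → Set X
  iUnion_eq : ⋃ i, set i = Set.univ

namespace Cover

/-- A map of covers `U → V`: a map `ξ` of the index sets with `U i ⊆ V (ξ i)` for all `i`. -/
@[ext]
structure Hom {X : Type u} (U V : Cover.{u, v} X) where
  toFun : U.ι → V.ι
  subset : ∀ i, U.set i ⊆ V.set (toFun i)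

instance {X : Type u} : Category (Cover.{u, v} X) where
  Hom := Hom
  id U := ⟨id, fun _ => subset_rfl⟩
  comp ξ ζ := ⟨ζ.toFun ∘ ξ.toFun, fun i => (ξ.subset i).trans (ζ.subset _)⟩

/-- A finite cover by path connected open sets. -/
structure IsFinitePathConnectedOpen {X : Type u} [TopologicalSpace X] (U : Cover.{u, v} X) :
    Prop where
  finite : Finite U.ι
  isOpen : ∀ i, IsOpen (U.set i)
  isPathConnected : ∀ i, IsPathConnected (U.set i)

end Cover

/-! ### Towers -/

/-- A tower of objects of a category `C` with resolution `res`: objects indexed by the real numbers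
`ε ≥ res` and, functorially, a morphism for every `ε ≤ ε'`. -/
structure Tower (C : Type u) [Category.{v} C] where
  /-- the resolution -/
  res : ℝ
  /-- the objects and the maps -/
  functor : Set.Ici res ⥤ C

namespace Tower

/-- Apply a functor to every object and every map of a tower. -/
def map {C : Type u} [Category.{v} C] {D : Type w} [Category.{t} D] (W : Tower C) (F : C ⥤ D) :
    Tower D :=
  ⟨W.res, W.functor ⋙ F⟩

/-- The tower `W` of resolution `r > 0`, reindexed by the logarithm: its resolution is `log r` and
its object at `ε` is the object of `W` at `exp ε`. -/
noncomputable def logReindex {C : Type u} [Category.{v} C] (W : Tower C) : Tower C where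
  res := Real.log W.res
  functor :=
    Monotone.functor
      (f := fun ε : Set.Ici (Real.log W.res) =>
        (⟨Real.exp ε, (Real.le_exp_log W.res).trans (Real.exp_le_exp.2 ε.2)⟩ : Set.Ici W.res))
      (fun _ _ h => Real.exp_le_exp.2 h) ⋙ W.functor

end Tower

/-! ### Pullback covers -/

namespace Cover

variable {X : Type u} [TopologicalSpace X]

/-- The set of points of `X` which form the path component `C` of the subspace `A`. -/
def componentSet {A : Set X} (C : ZerothHomotopy A) : Set X :=
  {x | ∃ h : x ∈ A, ZerothHomotopy.mk (⟨x, h⟩ : A) = C}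

/-- For `A ⊆ B`, the path component of `B` that contains a given path component of `A`. -/
def componentMap {A B : Set X} (h : A ⊆ B) : ZerothHomotopy A → ZerothHomotopy B :=
  ZerothHomotopy.lift (fun x => ZerothHomotopy.mk (Set.inclusion h x))
    (fun _ _ p => ZerothHomotopy.sound (p.map (continuous_inclusion h)))

lemma componentSet_subset {A B : Set X} (h : A ⊆ B) (C : ZerothHomotopy A) :
    componentSet C ⊆ componentSet (componentMap h C) := by
  rintro x ⟨hx, rfl⟩
  exact ⟨h hx, rfl⟩

/-- The pullback along `f : X → Z`: a cover `U` of `Z` is sent to the cover of `X` by the path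
components of the sets `f ⁻¹' U i`, and a map of covers `U → V` given by `ξ` to the map sending a
path component of `f ⁻¹' U i` to the path component of `f ⁻¹' V (ξ i)` that contains it. -/
def pullback {Z : Type w} (f : X → Z) : Cover.{w, v} Z ⥤ Cover.{u, max u v} X where
  obj U :=
    { ι := Σ i : U.ι, ZerothHomotopy (f ⁻¹' U.set i)
      set := fun p => componentSet p.2
      iUnion_eq := by
        refine Set.eq_univ_of_forall fun x => ?_
        have hx : f x ∈ ⋃ i, U.set i := by rw [U.iUnion_eq]; trivial
        obtain ⟨i, hi⟩ := Set.mem_iUnion.1 hx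
        exact Set.mem_iUnion.2 ⟨⟨i, ZerothHomotopy.mk ⟨x, hi⟩⟩, hi, rfl⟩ }
  map {U V} ξ :=
    { toFun := fun p => ⟨ξ.toFun p.1, componentMap (Set.preimage_mono (ξ.subset p.1)) p.2⟩
      subset := fun _ => componentSet_subset _ _ }
  map_id U := by
    apply Cover.Hom.ext
    funext ⟨i, C⟩
    induction C with
    | mk x => rfl
  map_comp ξ ζ := by
    apply Cover.Hom.ext
    funext ⟨i, C⟩
    induction C with
    | mk x => rfl

end Cover

/-! ### Simplicial complexes, nerves and simplicial homology -/

/-- An abstract simplicial complex, bundled with its vertex type. (Not every element of the vertex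
type has to be a face.) -/
structure SimplicialComplex where
  /-- the type of vertices -/
  V : Type v
  /-- the faces -/
  complex : PreAbstractSimplicialComplex V

namespace SimplicialComplex

open Classical in
/-- A simplicial map: a map of vertices that sends faces to faces. -/
@[ext]
structure Hom (K L : SimplicialComplex.{v}) where
  toFun : K.V → L.V
  image_mem : ∀ σ ∈ K.complex, σ.image toFun ∈ L.complex

instance : Category SimplicialComplex.{v} where
  Hom := Hom
  id K := ⟨id, fun σ hσ => by simpa using hσ⟩
  comp φ ψ := ⟨ψ.toFun ∘ φ.toFun, fun σ hσ => by
    classical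
    simpa [Finset.image_image] using ψ.image_mem _ (φ.image_mem σ hσ)⟩

open Classical in
/-- The simplicial set of ordered simplices of a simplicial complex: its `n`-simplices are the
tuples `(v₀, …, vₙ)` of vertices, repetitions allowed, such that `{v₀, …, vₙ}` is a face. Its chain
complex is the ordered chain complex of the simplicial complex, which computes the simplicial
homology. -/
def toSSet : SimplicialComplex.{v} ⥤ SSet.{v} where
  obj K :=
    { obj := fun n =>
        {σ : Fin (n.unop.len + 1) → K.V // Finset.univ.image σ ∈ K.complex}
      map := fun {m n} θ => ↾fun σ => ⟨σ.1 ∘ θ.unop.toOrderHom, by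
        refine (K.complex.isRelLowerSet_faces σ.2).2 ?_ (Finset.univ_nonempty.image _)
        intro x hx
        obtain ⟨i, -, rfl⟩ := Finset.mem_image.1 hx
        exact Finset.mem_image_of_mem _ (Finset.mem_univ _)⟩ }
  map {K L} φ :=
    { app := fun n => ↾fun σ => ⟨φ.toFun ∘ σ.1, by
        rw [← Finset.image_image]
        exact φ.image_mem _ σ.2⟩ }

/-- The `n`-th simplicial homology with coefficients in the field `𝕜`. -/
noncomputable def homology (𝕜 : Type w) [Field 𝕜] (n : ℕ) :
    SimplicialComplex.{v} ⥤ ModuleCat.{max v w} 𝕜 :=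
  toSSet ⋙ SSet.homologyFunctor (ModuleCat.of 𝕜 (ULift.{v} 𝕜)) n

end SimplicialComplex

/-- The nerve of a cover: a nonempty finite set of indices is a face iff the intersection of the
corresponding members of the cover is nonempty. -/
def Cover.nerve {X : Type u} : Cover.{u, v} X ⥤ SimplicialComplex.{v} where
  obj U :=
    { V := U.ι
      complex :=
        { faces := {σ | σ.Nonempty ∧ (⋂ i ∈ σ, U.set i).Nonempty}
          isRelLowerSet_faces := fun _ hσ =>
            ⟨hσ.1, fun _ hτσ hτ => ⟨hτ, hσ.2.mono (Set.biInter_mono hτσ fun _ _ => subset_rfl)⟩⟩ } }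
  map {U V} ξ :=
    { toFun := ξ.toFun
      image_mem := by
        classical
        rintro σ ⟨hσ, x, hx⟩
        refine ⟨hσ.image _, x, ?_⟩
        simp only [Set.mem_iInter, Finset.mem_image] at hx ⊢
        rintro _ ⟨i, hi, rfl⟩
        exact ξ.subset i (hx i hi) }

/-- The multiscale mapper: the tower of the nerves of the pullbacks of the covers of `W`. -/
def multiscaleMapper {X : Type u} [TopologicalSpace X] {Z : Type w} (W : Tower (Cover.{w, v} Z))
    (f : X → Z) : Tower SimplicialComplex.{max u v} :=
  W.map (Cover.pullback f ⋙ Cover.nerve)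

/-! ### Persistence diagrams -/

/-- A persistence diagram, as a multiset of points `(b, d)` with birth `b` and death `d`, possibly
infinite: the function giving the multiplicity of each point. -/
abbrev PersistenceDiagram := ℝ × WithTop ℝ → ℕ

namespace Tower

variable {𝕜 : Type w} [Field 𝕜]

/-- The rank of the map `V_a → V_b` of a persistence module, for `a ≤ b`. The module is understood to
be zero at the indices below the resolution. -/
noncomputable def rank (V : Tower (ModuleCat.{v} 𝕜)) (a b : ℝ) : ℕ :=
  open Classical in
  if h : V.res ≤ a ∧ a ≤ b then
    Module.finrank 𝕜 (LinearMap.range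
      (V.functor.map (homOfLE (show (⟨a, h.1⟩ : Set.Ici V.res) ≤ ⟨b, h.1.trans h.2⟩ from h.2))).hom)
  else 0

/-- The persistence diagram of a (pointwise finite dimensional) persistence module. The expression
`rank (b + ε) (d - ε) - rank (b - ε) (d - ε) - rank (b + ε) (d + ε) + rank (b - ε) (d + ε)` counts
the classes born between `b - ε` and `b + ε` that die between `d - ε` and `d + ε`. It does not
increase as `ε` decreases, and the multiplicity of `(b, d)` is its limit, i.e. its least value.
Likewise, `rank (b + ε) c - rank (b - ε) c` counts the classes born between `b - ε` and `b + ε` that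
are alive at `c`; the multiplicity of `(b, ∞)` is the least value for small `ε` and large `c`. -/
noncomputable def persistenceDiagram (V : Tower (ModuleCat.{v} 𝕜)) : PersistenceDiagram
  | (b, some d) => sInf {m : ℕ | ∃ ε > 0, b + ε < d - ε ∧
      (m : ℤ) = (V.rank (b + ε) (d - ε) : ℤ) - V.rank (b - ε) (d - ε)
        - V.rank (b + ε) (d + ε) + V.rank (b - ε) (d + ε)}
  | (b, none) => sInf {m : ℕ | ∃ ε > 0, ∃ c > b + ε,
      (m : ℤ) = (V.rank (b + ε) c : ℤ) - V.rank (b - ε) c}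

/-- The persistence diagram in dimension `k` of a tower of simplicial complexes, with coefficients
in the field `𝕜`. -/
noncomputable def diagram (𝕜 : Type w) [Field 𝕜] (k : ℕ) (S : Tower SimplicialComplex.{v}) :
    PersistenceDiagram :=
  (S.map (SimplicialComplex.homology 𝕜 k)).persistenceDiagram

end Tower

namespace PersistenceDiagram

/-- The points of a diagram, each repeated as often as its multiplicity says. -/
def Points (D : PersistenceDiagram) : Type := Σ p : ℝ × WithTop ℝ, Fin (D p)

/-- The `ℓ^∞` distance between two points of the extended plane. -/
noncomputable def pointDist : ℝ × WithTop ℝ → ℝ × WithTop ℝ → ℝ≥0∞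
  | (b, some d), (b', some d') => max (edist b b') (edist d d')
  | (b, none), (b', none) => edist b b'
  | (_, some _), (_, none) => ⊤
  | (_, none), (_, some _) => ⊤

/-- The `ℓ^∞` distance of a point of the extended plane from the diagonal. -/
noncomputable def diagonalDist : ℝ × WithTop ℝ → ℝ≥0∞
  | (b, some d) => edist b d / 2
  | (_, none) => ⊤

/-- `M` is a partial matching between the points of `D` and the points of `E` in which matched
points are at distance at most `r` and unmatched points are at distance at most `r` from the
diagonal. -/
structure IsMatching (D E : PersistenceDiagram) (r : ℝ≥0∞) (M : D.Points → E.Points → Prop) :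
    Prop where
  left_unique : ∀ p p' q, M p q → M p' q → p = p'
  right_unique : ∀ p q q', M p q → M p q' → q = q'
  matched : ∀ p q, M p q → pointDist p.1 q.1 ≤ r
  unmatched_left : ∀ p, (∀ q, ¬ M p q) → diagonalDist p.1 ≤ r
  unmatched_right : ∀ q, (∀ p, ¬ M p q) → diagonalDist q.1 ≤ r

/-- The bottleneck distance between two persistence diagrams. -/
noncomputable def bottleneckDist (D E : PersistenceDiagram) : ℝ≥0∞ :=
  sInf {r | ∃ M, IsMatching D E r M}

end PersistenceDiagram

/-! ### Well-behaved maps and good towers of covers -/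

/-- `f` is well-behaved: the preimage of every path connected open set has finitely many path
components. -/
def IsWellBehaved {X : Type u} [TopologicalSpace X] {Z : Type v} [TopologicalSpace Z]
    (f : X → Z) : Prop :=
  ∀ U : Set Z, IsOpen U → IsPathConnected U → Finite (ZerothHomotopy (f ⁻¹' U))

/-- A `(c, s)`-good tower of covers of the compact metric space `Z`. -/
structure IsGoodTower {Z : Type u} [MetricSpace Z] (c s : ℝ) (W : Tower (Cover.{u, v} Z)) :
    Prop where
  one_le : 1 ≤ c
  pos : 0 < s
  isFinitePathConnectedOpen : ∀ ε, (W.functor.obj ε).IsFinitePathConnectedOpen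
  res_eq : W.res = s
  le_diam : s ≤ Metric.diam (Set.univ : Set Z)
  diam_le : ∀ ε i, Metric.diam ((W.functor.obj ε).set i) ≤ ε
  exists_superset : ∀ O : Set Z, s ≤ Metric.diam O →
    ∃ h : W.res ≤ c * Metric.diam O, ∃ i, O ⊆ (W.functor.obj ⟨c * Metric.diam O, h⟩).set i

/-!
Two maps of covers `U ⟶ V` induce contiguous simplicial maps of the nerves, hence the same map in
homology. So homology does not see which maps of covers are chosen, and two towers with maps of
covers back and forth, shifted by `η`, are interleaved without any compatibility to be checked.
For `f` and `g` at distance at most `m ≥ s`, such maps come from goodness: the closed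
`m`-neighbourhood of a member of the cover at `ε` has diameter between `s` (by connectedness) and
`ε + 2 * m`, so it lies in a member of the cover at `c * (ε + 2 * m)`; on the logarithmic scale
this is a bounded shift.

For the stability of the diagrams only ranks matter. A rank function `r` is a discrete
distribution function, and the multiplicity of `(b, d)` is its mixed jump, so it can be computed
as the drop at `d` of the rise at `b` or the other way round. For an interleaved pair, the image
of the first module in the shifted second one is a quotient of the one and a submodule of the
other. A quotient map keeps the births and can only move deaths to earlier times: among the bars
born at `b` the monotone matching of deaths does the job, as in the induced matchings of Bauer and
Lesnick. Submodules are dual, with the roles of births and deaths exchanged.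
-/

/-! ### Jumps of monotone functions -/

/-- The drop of an antitone function `g` at `d`, that is `g(d⁻) - g(d⁺)`; at `⊤`, the limit of `g`
at infinity. If `g c` counts the bars of a family that are alive at `c`, this is the number of bars
dying at `d`. -/
noncomputable def dropAt (g : ℝ → ℕ) : WithTop ℝ → ℕ
  | some d => Filter.liminf (fun ε => g (d - ε) - g (d + ε)) (𝓝[>] 0)
  | none => Filter.liminf g Filter.atTop

/-- The rise `g(b⁺) - g(b⁻)` of a monotone function `g` at `b`. If `g a` counts the bars of a family
that are born up to `a`, this is the number of bars born at `b`. -/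
noncomputable def riseAt (g : ℝ → ℕ) (b : ℝ) : ℕ :=
  Filter.liminf (fun ε => g (b + ε) - g (b - ε)) (𝓝[>] 0)

section Jumps

variable {g : ℝ → ℕ} {S : Set ℝ} {b d : ℝ}

lemma eventually_eq_liminf_of_monotoneOn (hS : S ∈ 𝓝[>] b) (hpos : S ⊆ Set.Ioi b)
    (hg : MonotoneOn g S) : ∀ᶠ ε in 𝓝[>] b, g ε = Filter.liminf g (𝓝[>] b) := by
  obtain ⟨x, hx⟩ : S.Nonempty := Filter.nonempty_of_mem hS
  obtain ⟨ε₀, h₀, h₀'⟩ := Nat.sInf_mem (⟨_, Set.mem_image_of_mem g hx⟩ : (g '' S).Nonempty)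
  have hmin : ∀ᶠ ε in 𝓝[>] b, g ε = sInf (g '' S) := by
    filter_upwards [hS, Ioo_mem_nhdsGT (hpos h₀)] with ε hε hε'
    exact le_antisymm (h₀' ▸ hg hε h₀ hε'.2.le) (Nat.sInf_le (Set.mem_image_of_mem g hε))
  rwa [Filter.liminf_congr hmin, Filter.liminf_const]

lemma dropAt_eq {m : ℕ} (h : ∀ᶠ ε in 𝓝[>] (0 : ℝ), g (d - ε) = g (d + ε) + m) :
    dropAt g d = m := by
  have hm : ∀ᶠ ε in 𝓝[>] (0 : ℝ), g (d - ε) - g (d + ε) = m := h.mono fun ε hε => by lia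
  exact (Filter.liminf_congr hm).trans (Filter.liminf_const m)

lemma dropAt_top_eq {m : ℕ} (h : ∀ᶠ c in Filter.atTop, g c = m) : dropAt g ⊤ = m :=
  (Filter.liminf_congr h).trans (Filter.liminf_const m)

lemma dropAt_const_zero (d : WithTop ℝ) : dropAt (fun _ => 0) d = 0 := by
  induction d with
  | top => exact dropAt_top_eq (.of_forall fun _ => rfl)
  | coe d => exact dropAt_eq (.of_forall fun _ => rfl)

lemma riseAt_eq_dropAt_neg (g : ℝ → ℕ) (b : ℝ) :
    riseAt g b = dropAt (fun x => g (-x)) ((-b : ℝ) : WithTop ℝ) := by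
  change _ = Filter.liminf (fun ε => g (-(-b - ε)) - g (-(-b + ε))) (𝓝[>] 0)
  simp only [riseAt, neg_add_eq_sub, neg_sub, sub_neg_eq_add, add_comm _ b]

lemma riseAt_eq {m : ℕ} (h : ∀ᶠ ε in 𝓝[>] (0 : ℝ), g (b + ε) = g (b - ε) + m) :
    riseAt g b = m := by
  have hm : ∀ᶠ ε in 𝓝[>] (0 : ℝ), g (b + ε) - g (b - ε) = m := h.mono fun ε hε => by lia
  exact (Filter.liminf_congr hm).trans (Filter.liminf_const m)

lemma dropAt_comp_add_right (g : ℝ → ℕ) (t : ℝ) (d : WithTop ℝ) :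
    dropAt (fun x => g (x + t)) d = dropAt g (d + t) := by
  induction d with
  | top =>
    change Filter.liminf (g ∘ OrderIso.addRight t) Filter.atTop = Filter.liminf g Filter.atTop
    rw [Filter.liminf_comp, (OrderIso.addRight t).map_atTop]
  | coe d =>
    change Filter.liminf (fun ε => g (d - ε + t) - g (d + ε + t)) _ =
      Filter.liminf (fun ε => g (d + t - ε) - g (d + t + ε)) _
    simp only [sub_add_eq_add_sub, add_right_comm]

lemma eventually_dropAt (hS : S ∈ 𝓝 d) (hg : AntitoneOn g S) :
    ∀ᶠ ε in 𝓝[>] (0 : ℝ), g (d - ε) = g (d + ε) + dropAt g d := by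
  obtain ⟨ε₀, h₀, hS⟩ := Metric.mem_nhds_iff.1 hS
  rw [Real.ball_eq_Ioo] at hS
  have hmem : ∀ ε ∈ Set.Ioo 0 ε₀, d - ε ∈ S ∧ d + ε ∈ S := fun ε hε =>
    ⟨hS ⟨by linarith [hε.2], by linarith [hε.1]⟩, hS ⟨by linarith [hε.1], by linarith [hε.2]⟩⟩
  have hmono : MonotoneOn (fun ε => g (d - ε) - g (d + ε)) (Set.Ioo 0 ε₀) :=
    fun x hx y hy hxy => tsub_le_tsub (hg (hmem y hy).1 (hmem x hx).1 (by linarith))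
      (hg (hmem x hx).2 (hmem y hy).2 (by linarith))
  filter_upwards [Ioo_mem_nhdsGT h₀, eventually_eq_liminf_of_monotoneOn (Ioo_mem_nhdsGT h₀)
    (fun _ hx => hx.1) hmono] with ε hε heq
  have := hg (hmem ε hε).1 (hmem ε hε).2 (by linarith [hε.1])
  change _ = _ + Filter.liminf _ _
  rw [← heq]
  lia

lemma eventually_dropAt_top {a : ℝ} (hg : AntitoneOn g (Set.Ici a)) :
    ∀ᶠ c in Filter.atTop, g c = dropAt g ⊤ := by
  obtain ⟨c₀, h₀, h₀'⟩ := Nat.sInf_mem (Set.nonempty_Ici.image g : (g '' Set.Ici a).Nonempty)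
  have hmin : ∀ᶠ c in Filter.atTop, g c = sInf (g '' Set.Ici a) := by
    filter_upwards [Filter.eventually_ge_atTop c₀] with c hc
    have hac : a ≤ c := (Set.mem_Ici.1 h₀).trans hc
    exact le_antisymm (h₀' ▸ hg h₀ hac hc) (Nat.sInf_le (Set.mem_image_of_mem g hac))
  rwa [dropAt_top_eq hmin]

lemma eventually_riseAt (hS : S ∈ 𝓝 b) (hg : MonotoneOn g S) :
    ∀ᶠ ε in 𝓝[>] (0 : ℝ), g (b + ε) = g (b - ε) + riseAt g b := by
  have hanti : AntitoneOn (fun x => g (-x)) (-S) := fun x hx y hy hxy =>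
    hg hy hx (neg_le_neg hxy)
  have hS' : -S ∈ 𝓝 (-b) := (continuous_neg.tendsto (-b)) (by rwa [neg_neg])
  rw [riseAt_eq_dropAt_neg]
  filter_upwards [eventually_dropAt hS' hanti] with ε hε
  simpa only [neg_add_eq_sub, neg_sub, sub_neg_eq_add, add_comm _ b] using hε

end Jumps

/-! ### Enumerating bars by their ends -/

/-- The last time at which the counting function `f`, defined on `S`, is larger than `n`. -/
noncomputable def exitTime (S : Set ℝ) (f : ℝ → ℕ) (n : ℕ) : WithTop ℝ :=
  sSup ((↑) '' {c | c ∈ S ∧ n < f c})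

/-- The family `A` of bars with ends `ℓ` is counted by `f`: on the open upper set `S` the drop of
`f` at `d` is the number of bars that end at `d`. -/
structure IsTailCount {α : Type*} (A : Set α) (ℓ : α → WithTop ℝ) (S : Set ℝ) (f : ℝ → ℕ) :
    Prop where
  isOpen : IsOpen S
  isUpperSet : IsUpperSet S
  nonempty : S.Nonempty
  antitoneOn : AntitoneOn f S
  mem_of_eq : ∀ p ∈ A, ∀ x : ℝ, ℓ p = x → x ∈ S
  encard_eq : ∀ d : WithTop ℝ, (∀ x : ℝ, d = x → x ∈ S) → (A ∩ ℓ ⁻¹' {d}).encard = dropAt f d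

section ExitTime

variable {S : Set ℝ} {f : ℝ → ℕ} {n : ℕ} {c d : ℝ}

lemma le_exitTime (hc : c ∈ S) (hn : n < f c) : c ≤ exitTime S f n :=
  le_csSup (OrderTop.bddAbove _) ⟨c, ⟨hc, hn⟩, rfl⟩

lemma le_of_exitTime_lt (hc : c ∈ S) (h : exitTime S f n < c) : f c ≤ n :=
  not_lt.1 fun hn => h.not_ge (le_exitTime hc hn)

lemma exitTime_le (hne : ∃ c ∈ S, n < f c) {d : WithTop ℝ}
    (h : ∀ c : ℝ, c ∈ S → d < c → f c ≤ n) : exitTime S f n ≤ d := by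
  obtain ⟨c, hc, hn⟩ := hne
  refine csSup_le ⟨c, c, ⟨hc, hn⟩, rfl⟩ ?_
  rintro _ ⟨x, ⟨hx, hnx⟩, rfl⟩
  exact not_lt.1 fun hdx => (h x hx hdx).not_gt hnx

lemma lt_of_lt_exitTime (hf : AntitoneOn f S) (hne : ∃ c ∈ S, n < f c) (hc : c ∈ S)
    (h : c < exitTime S f n) : n < f c :=
  not_le.1 fun hn => h.not_ge <| exitTime_le hne fun _ hx hcx =>
    (hf hc hx (WithTop.coe_le_coe.1 hcx.le)).trans hn

lemma exists_eventually_right_eq (hS : IsUpperSet S) (hf : AntitoneOn f S) (hd : d ∈ S) :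
    ∃ m, ∀ᶠ ε in 𝓝[>] (0 : ℝ), f (d + ε) = m := by
  have hmem : ∀ ε > 0, d + ε ∈ S := fun ε hε => hS (le_add_of_nonneg_right hε.le) hd
  have hmono : MonotoneOn (fun ε => f d - f (d + ε)) (Set.Ioi 0) := fun x hx y hy hxy =>
    Nat.sub_le_sub_left (hf (hmem x hx) (hmem y hy) (by gcongr)) _
  refine ⟨f d - Filter.liminf (fun ε => f d - f (d + ε)) (𝓝[>] 0), ?_⟩
  filter_upwards [self_mem_nhdsWithin,
    eventually_eq_liminf_of_monotoneOn self_mem_nhdsWithin subset_rfl hmono] with ε hε heq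
  rw [← heq, Nat.sub_sub_self (hf hd (hmem ε hε) (le_add_of_nonneg_right (le_of_lt hε)))]

lemma setOf_exitTime_eq_top (hS : IsUpperSet S) (hne : S.Nonempty) (hf : AntitoneOn f S) :
    {n | (∃ c ∈ S, n < f c) ∧ exitTime S f n = ⊤} = Set.Iio (dropAt f ⊤) := by
  obtain ⟨a, ha⟩ := hne
  have hev := (eventually_dropAt_top (hf.mono (hS.Ici_subset ha))).and
    (Filter.eventually_ge_atTop a)
  ext n
  constructor
  · rintro ⟨hn, hexit⟩
    obtain ⟨c, hc, hac⟩ := hev.exists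
    exact hc ▸ lt_of_lt_exitTime hf hn (hS hac ha) (hexit ▸ WithTop.coe_lt_top c)
  · intro hn
    have hlt : ∀ᶠ c in Filter.atTop, c ∈ S ∧ n < f c :=
      hev.mono fun c hc => ⟨hS hc.2 ha, hc.1 ▸ hn⟩
    refine ⟨hlt.exists, WithTop.eq_top_iff_forall_ge.2 fun x => ?_⟩
    obtain ⟨c, ⟨hc, hnc⟩, hxc⟩ := (hlt.and (Filter.eventually_ge_atTop x)).exists
    exact (WithTop.coe_le_coe.2 hxc).trans (le_exitTime hc hnc)

lemma exists_setOf_exitTime_eq_coe (hS : IsUpperSet S) (hSo : IsOpen S) (hf : AntitoneOn f S)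
    (hd : d ∈ S) :
    ∃ m, {n | (∃ c ∈ S, n < f c) ∧ exitTime S f n = d} = Set.Ico m (m + dropAt f d) := by
  obtain ⟨m, hm⟩ := exists_eventually_right_eq hS hf hd
  have hS' : ∀ᶠ ε in 𝓝[>] (0 : ℝ), d - ε ∈ S :=
    (Filter.Tendsto.mono_left (by simpa using (continuous_sub_left d).tendsto 0)
      nhdsWithin_le_nhds).eventually (hSo.mem_nhds hd)
  have hev := (hm.and (eventually_dropAt (hSo.mem_nhds hd) hf)).and (hS'.and self_mem_nhdsWithin)
  refine ⟨m, Set.ext fun n => ⟨fun ⟨hn, hexit⟩ => ?_, fun ⟨hmn, hnm⟩ => ?_⟩⟩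
  · obtain ⟨ε, ⟨h₁, h₂⟩, hε, hpos : 0 < ε⟩ := hev.exists
    rw [← h₁, ← h₂]
    refine ⟨le_of_exitTime_lt (hS (by linarith) hd) ?_, lt_of_lt_exitTime hf hn hε ?_⟩ <;>
      exact hexit ▸ WithTop.coe_lt_coe.2 (by linarith)
  · have hlt : ∀ᶠ ε in 𝓝[>] (0 : ℝ), d - ε ∈ S ∧ n < f (d - ε) :=
      hev.mono fun ε ⟨⟨h₁, h₂⟩, h₃, _⟩ => ⟨h₃, by rwa [h₂, h₁]⟩
    have hne : ∃ c ∈ S, n < f c := hlt.exists.imp' _ fun _ => id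
    refine ⟨hne, (exitTime_le hne fun c hc hdc => ?_).antisymm (le_of_forall_lt fun x hx => ?_)⟩
    · obtain ⟨ε, ⟨⟨h₁, _⟩, _, _⟩, hεc⟩ := (hev.and
        (Ioo_mem_nhdsGT (sub_pos.2 (WithTop.coe_lt_coe.1 hdc)))).exists
      exact (hf (hS (by linarith [hεc.1]) hd) hc (by linarith [hεc.2])).trans (h₁.trans_le hmn)
    · lift x to ℝ using hx.ne_top
      obtain ⟨ε, ⟨hε, hn⟩, hεx⟩ := (hlt.and
        (Ioo_mem_nhdsGT (sub_pos.2 (WithTop.coe_lt_coe.1 hx)))).exists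
      exact (WithTop.coe_lt_coe.2 (by linarith [hεx.2])).trans_le (le_exitTime hε hn)

end ExitTime

namespace IsTailCount

variable {α : Type*} {A : Set α} {ℓ : α → WithTop ℝ} {S : Set ℝ} {f : ℝ → ℕ}

lemma encard_setOf_exitTime_eq (h : IsTailCount A ℓ S f) {d : WithTop ℝ}
    (hd : ∀ x : ℝ, d = x → x ∈ S) :
    {n | (∃ c ∈ S, n < f c) ∧ exitTime S f n = d}.encard = dropAt f d := by
  induction d with
  | top =>
    rw [setOf_exitTime_eq_top h.isUpperSet h.nonempty h.antitoneOn, Set.encard_eq_coe_toFinset_card]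
    simp
  | coe d =>
    obtain ⟨m, hm⟩ :=
      exists_setOf_exitTime_eq_coe h.isUpperSet h.isOpen h.antitoneOn (hd d rfl)
    rw [hm, Set.encard_eq_coe_toFinset_card]
    simp

lemma exitTime_mem (h : IsTailCount A ℓ S f) {n : ℕ} (hn : ∃ c ∈ S, n < f c) {x : ℝ}
    (hx : exitTime S f n = x) : x ∈ S := by
  obtain ⟨c, hc, hnc⟩ := hn
  exact h.isUpperSet (WithTop.coe_le_coe.1 (hx ▸ le_exitTime hc hnc)) hc

theorem exists_bijOn (h : IsTailCount A ℓ S f) :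
    ∃ k : α → ℕ, Set.BijOn k A {n | ∃ c ∈ S, n < f c} ∧ ∀ p ∈ A, exitTime S f (k p) = ℓ p := by
  have hfib : ∀ d : WithTop ℝ, ∃ k : α → ℕ, (∀ x : ℝ, d = x → x ∈ S) →
      Set.BijOn k (A ∩ ℓ ⁻¹' {d}) {n | (∃ c ∈ S, n < f c) ∧ exitTime S f n = d} := by
    intro d
    by_cases hd : ∀ x : ℝ, d = x → x ∈ S
    · have heq := (h.encard_eq d hd).trans (h.encard_setOf_exitTime_eq hd).symm
      have hfin : (A ∩ ℓ ⁻¹' {d}).Finite :=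
        Set.finite_of_encard_eq_coe (h.encard_eq d hd)
      obtain ⟨k, hk⟩ := hfin.exists_bijOn_of_encard_eq heq
      exact ⟨k, fun _ => hk⟩
    · exact ⟨0, fun h => absurd h hd⟩
  choose k hk using hfib
  have hk' : ∀ p ∈ A, k (ℓ p) p ∈ {n | (∃ c ∈ S, n < f c) ∧ exitTime S f n = ℓ p} :=
    fun p hp => (hk (ℓ p) (h.mem_of_eq p hp)).mapsTo ⟨hp, rfl⟩
  refine ⟨fun p => k (ℓ p) p, ⟨fun p hp => (hk' p hp).1, fun p hp q hq hpq => ?_, fun n hn => ?_⟩,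
    fun p hp => (hk' p hp).2⟩
  · have heq : ℓ p = ℓ q := (hk' p hp).2.symm.trans ((congrArg _ hpq).trans (hk' q hq).2)
    refine (hk (ℓ p) (h.mem_of_eq p hp)).injOn ⟨hp, rfl⟩ ⟨hq, heq.symm⟩ ?_
    exact hpq.trans (by rw [heq])
  · obtain ⟨p, ⟨hp, hpd⟩, hpn⟩ := (hk _ fun x hx => h.exitTime_mem hn hx).surjOn ⟨hn, rfl⟩
    exact ⟨p, hp, by simpa only [show ℓ p = _ from hpd] using hpn⟩

end IsTailCount

section Fiberwise

variable {S S' : Set ℝ} {f f' : ℝ → ℕ} {n : ℕ}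

lemma exitTime_le_add {u : ℝ} (hle : ∀ c ∈ S', c - u ∈ S ∧ f' c ≤ f (c - u))
    (hn : ∃ c ∈ S', n < f' c) : exitTime S' f' n ≤ exitTime S f n + u := by
  refine exitTime_le hn fun c hc hlt => not_lt.1 fun hnc => hlt.not_ge ?_
  calc (c : WithTop ℝ) = ((c - u : ℝ) : WithTop ℝ) + u := by rw [← WithTop.coe_add, sub_add_cancel]
    _ ≤ exitTime S f n + u := by gcongr; exact le_exitTime (hle c hc).1 (hnc.trans_le (hle c hc).2)

lemma exitTime_le_exitTime_add {v : ℝ} (hS' : IsUpperSet S')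
    (hle : ∀ c ∈ S', f (c + v) ≤ f' c) (hn : ∃ c ∈ S, n < f c) (hn' : ∃ c ∈ S', n < f' c) :
    exitTime S f n ≤ exitTime S' f' n + v := by
  obtain ⟨c', hc', hnc'⟩ := hn'
  refine exitTime_le hn fun c _ hlt => ?_
  have hlt' : exitTime S' f' n < (c - v : ℝ) := by
    refine lt_of_not_ge fun hge => hlt.not_ge ?_
    calc (c : WithTop ℝ) = ((c - v : ℝ) : WithTop ℝ) + v := by
          rw [← WithTop.coe_add, sub_add_cancel]
      _ ≤ exitTime S' f' n + v := by gcongr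
  have hmem : c - v ∈ S' :=
    hS' (WithTop.coe_le_coe.1 ((le_exitTime hc' hnc').trans hlt'.le)) hc'
  calc f c = f (c - v + v) := by rw [sub_add_cancel]
    _ ≤ f' (c - v) := hle _ hmem
    _ ≤ n := le_of_exitTime_lt hmem hlt'

variable {α α' B B' : Type*} {β : α → B} {β' : α' → B'} {ℓ : α → WithTop ℝ} {ℓ' : α' → WithTop ℝ}

/-- The bars of each family are listed by decreasing end; `μ` pairs bars in the same position. -/
theorem exists_injective_of_isTailCount {S : B → Set ℝ} {f : B → ℝ → ℕ}
    {S' : B' → Set ℝ} {f' : B' → ℝ → ℕ} (h : ∀ b, IsTailCount (β ⁻¹' {b}) ℓ (S b) (f b))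
    (h' : ∀ b, IsTailCount (β' ⁻¹' {b}) ℓ' (S' b) (f' b)) {σ : B' → B}
    (hσ : Function.Injective σ) {u v : ℝ} (huv : 0 ≤ u + v)
    (hle : ∀ b, ∀ c ∈ S' b, c - u ∈ S (σ b) ∧ f' b c ≤ f (σ b) (c - u))
    (hge : ∀ b, ∀ c ∈ S' b, f (σ b) (c + v) ≤ f' b c) :
    ∃ μ : α' → α, Function.Injective μ ∧
      (∀ q, β (μ q) = σ (β' q) ∧ ℓ' q ≤ ℓ (μ q) + u ∧ ℓ (μ q) ≤ ℓ' q + v) ∧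
      ∀ p b c, β p = σ b → c ∈ S' b → ((c + v : ℝ) : WithTop ℝ) < ℓ p → p ∈ Set.range μ := by
  choose k hk hkℓ using fun b => (h b).exists_bijOn
  choose k' hk' hkℓ' using fun b => (h' b).exists_bijOn
  have hpos : ∀ b n, (∃ c ∈ S' b, n < f' b c) → ∃ c ∈ S (σ b), n < f (σ b) c :=
    fun b n ⟨c, hc, hn⟩ => ⟨c - u, (hle b c hc).1, hn.trans_le (hle b c hc).2⟩
  have hn' : ∀ q, ∃ c ∈ S' (β' q), k' (β' q) q < f' (β' q) c := fun q => (hk' (β' q)).mapsTo rfl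
  choose μ hμβ hμk using fun q => (hk (σ (β' q))).surjOn (hpos _ _ (hn' q))
  have hμβ : ∀ q, β (μ q) = σ (β' q) := hμβ
  refine ⟨μ, fun q q' heq => ?_, fun q => ⟨hμβ q, ?_, ?_⟩, fun p b c hpb hc hlt => ?_⟩
  · have hβ : β' q' = β' q := hσ ((hμβ q').symm.trans ((congrArg β heq.symm).trans (hμβ q)))
    refine (hk' (β' q)).injOn rfl hβ ?_
    rw [← hμk q, heq, ← hβ, hμk q']
  · rw [← hkℓ' _ q rfl, ← hkℓ _ _ (hμβ q), hμk q]
    exact exitTime_le_add (hle _) (hn' q)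
  · rw [← hkℓ' _ q rfl, ← hkℓ _ _ (hμβ q), hμk q]
    exact exitTime_le_exitTime_add (h' _).isUpperSet (hge _) (hpos _ _ (hn' q)) (hn' q)
  · have hcv : c + v ∈ S (σ b) := (h _).isUpperSet (by linarith) (hle b c hc).1
    have hn := lt_of_lt_exitTime (h _).antitoneOn ((hk _).mapsTo hpb) hcv
      (hlt.trans_eq (hkℓ _ p hpb).symm)
    obtain ⟨q, rfl, hqk⟩ := (hk' b).surjOn ⟨c, hc, hn.trans_le (hge b c hc)⟩
    exact ⟨q, (hk (σ (β' q))).injOn (hμβ q) hpb ((hμk q).trans hqk)⟩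

end Fiberwise

/-! ### Rank functions and their persistence diagrams -/

/-- The inequalities satisfied by the ranks of the maps of a persistence module indexed by `P`; the
last one is Frobenius' rank inequality. -/
structure IsRankFunction {P : Type*} [Preorder P] (r : P → P → ℕ) : Prop where
  mono : ∀ {a' a b}, a' ≤ a → a ≤ b → r a' b ≤ r a b
  anti : ∀ {a b b'}, a ≤ b → b ≤ b' → r a b' ≤ r a b
  rect : ∀ {a' a b b'}, a' ≤ a → a ≤ b → b ≤ b' → r a' b + r a b' ≤ r a b + r a' b'

/-- The number of bars born between `a` and `a'` that die between `c` and `c'`. -/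
def boxCount (r : ℝ → ℝ → ℕ) (a a' c c' : ℝ) : ℤ := r a' c - r a c - r a' c' + r a c'

/-- The persistence diagram determined by a rank function, given by the formulas that define
`Tower.persistenceDiagram`. -/
noncomputable def rankDiagram (r : ℝ → ℝ → ℕ) : PersistenceDiagram
  | (b, some d) => sInf {m : ℕ | ∃ ε > 0, b + ε < d - ε ∧
      (m : ℤ) = boxCount r (b - ε) (b + ε) (d - ε) (d + ε)}
  | (b, none) => sInf {m : ℕ | ∃ ε > 0, ∃ c > b + ε, (m : ℤ) = (r (b + ε) c : ℤ) - r (b - ε) c}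

section RankDiagram

variable {r r' : ℝ → ℝ → ℕ}

lemma rankDiagram_congr (h : ∀ a b, a ≤ b → r a b = r' a b) : rankDiagram r = rankDiagram r' := by
  funext ⟨b, d⟩
  induction d with
  | top =>
    change sInf {m : ℕ | _} = sInf {m : ℕ | _}
    congr! 5 with m ε
    refine and_congr_right fun hε => exists_congr fun c => and_congr_right fun hc => ?_
    rw [h _ _ hc.le, h _ _ (by linarith)]
  | coe d =>
    change sInf {m : ℕ | _} = sInf {m : ℕ | _}
    congr! 5 with m ε
    refine and_congr_right fun hε => and_congr_right fun hlt => ?_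
    simp only [boxCount]
    rw [h _ _ hlt.le, h _ _ (by linarith), h _ _ (by linarith), h _ _ (by linarith)]

lemma rankDiagram_eq_zero {b : ℝ} {d : WithTop ℝ} (hdb : d ≤ b) : rankDiagram r (b, d) = 0 := by
  lift d to ℝ using ne_top_of_le_ne_top WithTop.coe_ne_top hdb
  have hdb := WithTop.coe_le_coe.1 hdb
  refine Nat.sInf_eq_zero.2 (Or.inr (Set.eq_empty_of_forall_notMem ?_))
  rintro m ⟨ε, hε, hlt, -⟩
  linarith

lemma birth_lt_death (p : (rankDiagram r).Points) : (p.1.1 : WithTop ℝ) < p.1.2 :=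
  not_le.1 fun hle => (Fin.cast (rankDiagram_eq_zero hle) p.2).elim0

end RankDiagram

lemma PersistenceDiagram.encard_setOf_fst_eq (D : PersistenceDiagram) (z : ℝ × WithTop ℝ) :
    {p : D.Points | p.1 = z}.encard = D z := by
  have : {p : D.Points | p.1 = z} = Set.range (Sigma.mk z) := by
    ext ⟨y, i⟩
    constructor
    · rintro rfl
      exact ⟨i, rfl⟩
    · rintro ⟨j, hj⟩
      exact (congrArg Sigma.fst hj).symm
  rw [this, ← Set.image_univ]
  exact (sigma_mk_injective.encard_image _).trans (by simp [Set.encard_univ])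

namespace IsRankFunction

section Curves

variable {P : Type*} [Preorder P] {R : P → P → ℕ} (hR : IsRankFunction R) {φ ψ : ℝ → P}
include hR

lemma comp (hφ : Monotone φ) (hψ : Monotone ψ) (hφψ : ∀ a, φ a ≤ ψ a) :
    IsRankFunction fun a b => R (φ a) (ψ b) where
  mono ha hab := hR.mono (hφ ha) ((hφψ _).trans (hψ hab))
  anti hab hb := hR.anti ((hφψ _).trans (hψ hab)) (hψ hb)
  rect ha hab hb := hR.rect (hφ ha) ((hφψ _).trans (hψ hab)) (hψ hb)

lemma eventually_riseAt (hφ : Monotone φ) {b b' : ℝ} (hb : b < b') {y : P} (hy : φ b' ≤ y) :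
    ∀ᶠ ε in 𝓝[>] (0 : ℝ), R (φ (b + ε)) y = R (φ (b - ε)) y + riseAt (fun a => R (φ a) y) b :=
  _root_.eventually_riseAt (g := fun a => R (φ a) y) (Iic_mem_nhds hb)
    fun _ _ _ hc hac => hR.mono (hφ hac) ((hφ hc).trans hy)

lemma eventually_dropAt (hψ : Monotone ψ) {d' d : ℝ} (hd : d' < d) {x : P} (hx : x ≤ ψ d') :
    ∀ᶠ ε in 𝓝[>] (0 : ℝ), R x (ψ (d - ε)) = R x (ψ (d + ε)) + dropAt (fun c => R x (ψ c)) d :=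
  _root_.eventually_dropAt (g := fun c => R x (ψ c)) (Ici_mem_nhds hd)
    fun _ ha _ _ hac => hR.anti (hx.trans (hψ ha)) (hψ hac)

lemma eventually_dropAt_top (hψ : Monotone ψ) {d' : ℝ} {x : P} (hx : x ≤ ψ d') :
    ∀ᶠ c in Filter.atTop, R x (ψ c) = dropAt (fun c => R x (ψ c)) ⊤ :=
  _root_.eventually_dropAt_top (a := d')
    fun _ ha _ _ hac => hR.anti (hx.trans (hψ ha)) (hψ hac)

lemma riseAt_le_riseAt (hφ : Monotone φ) {b b' : ℝ} (hb : b < b') {y y' : P} (hy : φ b' ≤ y)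
    (hyy' : y ≤ y') : riseAt (fun a => R (φ a) y') b ≤ riseAt (fun a => R (φ a) y) b := by
  obtain ⟨ε, ⟨h, h'⟩, hpos, hε⟩ := ((hR.eventually_riseAt hφ hb hy).and
    (hR.eventually_riseAt hφ hb (hy.trans hyy'))).and (Ioo_mem_nhdsGT (sub_pos.2 hb)) |>.exists
  have := hR.rect (hφ (show b - ε ≤ b + ε by linarith))
    ((hφ (show b + ε ≤ b' by linarith)).trans hy) hyy'
  lia

lemma dropAt_le_dropAt (hψ : Monotone ψ) {d' : ℝ} {d : WithTop ℝ} (hd : d' < d) {x x' : P}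
    (hxx' : x ≤ x') (hx' : x' ≤ ψ d') :
    dropAt (fun c => R x (ψ c)) d ≤ dropAt (fun c => R x' (ψ c)) d := by
  induction d with
  | top =>
    obtain ⟨c, ⟨h, h'⟩, hc⟩ := ((hR.eventually_dropAt_top hψ (hxx'.trans hx')).and
      (hR.eventually_dropAt_top hψ hx')).and (Filter.eventually_ge_atTop d') |>.exists
    exact h ▸ h' ▸ hR.mono hxx' (hx'.trans (hψ hc))
  | coe d =>
    have hd := WithTop.coe_lt_coe.1 hd
    obtain ⟨ε, ⟨h, h'⟩, hpos, hε⟩ := ((hR.eventually_dropAt hψ hd (hxx'.trans hx')).and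
      (hR.eventually_dropAt hψ hd hx')).and (Ioo_mem_nhdsGT (sub_pos.2 hd)) |>.exists
    have := hR.rect hxx' (hx'.trans (hψ (show d' ≤ d - ε by linarith)))
      (hψ (show d - ε ≤ d + ε by linarith))
    lia

end Curves

variable {r : ℝ → ℝ → ℕ} (h : IsRankFunction r)
include h

lemma boxCount_mono {a₁ a a' a₁' c₁ c c' c₁' : ℝ} (h₁ : a₁ ≤ a) (h₂ : a ≤ a') (h₃ : a' ≤ a₁')
    (h₄ : a₁' ≤ c₁) (h₅ : c₁ ≤ c) (h₆ : c ≤ c') (h₇ : c' ≤ c₁') :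
    boxCount r a a' c c' ≤ boxCount r a₁ a₁' c₁ c₁' := by
  have := h.rect h₁ (h₂.trans (h₃.trans h₄)) (h₅.trans (h₆.trans h₇))
  have := h.rect h₃ h₄ (h₅.trans (h₆.trans h₇))
  have := h.rect h₂ (h₃.trans h₄) h₅
  have := h.rect h₂ (h₃.trans (h₄.trans (h₅.trans h₆))) h₇
  unfold boxCount
  lia

lemma exists_forall_boxCount_eq_rankDiagram {b d : ℝ} (hbd : b < d) :
    ∃ ε₀ > 0, b + ε₀ < d - ε₀ ∧ ∀ x ∈ Set.Ioc 0 ε₀, ∀ y ∈ Set.Ioc 0 ε₀,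
      boxCount r (b - x) (b + x) (d - y) (d + y) = rankDiagram r (b, d) := by
  set T := {m : ℕ | ∃ ε > 0, b + ε < d - ε ∧
    (m : ℤ) = boxCount r (b - ε) (b + ε) (d - ε) (d + ε)}
  have hT : ∀ ε > 0, b + ε < d - ε →
      ∃ m ∈ T, (m : ℤ) = boxCount r (b - ε) (b + ε) (d - ε) (d + ε) := fun ε hε hlt => by
    have := h.rect (show b - ε ≤ b + ε by linarith) hlt.le (show d - ε ≤ d + ε by linarith)
    lift boxCount r (b - ε) (b + ε) (d - ε) (d + ε) to ℕ using by unfold boxCount; lia with m hm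
    exact ⟨m, ⟨ε, hε, hlt, hm⟩, rfl⟩
  obtain ⟨m, hm, -⟩ := hT ((d - b) / 3) (by linarith) (by linarith)
  obtain ⟨ε₀, h₀, hlt, hmin⟩ := Nat.sInf_mem ⟨m, hm⟩
  refine ⟨ε₀, h₀, hlt, fun x hx y hy => le_antisymm ?_ ?_⟩
  · exact (h.boxCount_mono (by linarith [hx.2]) (by linarith [hx.1]) (by linarith [hx.2]) hlt.le
      (by linarith [hy.2]) (by linarith [hy.1]) (by linarith [hy.2])).trans_eq hmin.symm
  · have hz := min_le_left x y
    have hz' := min_le_right x y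
    have hpos := lt_min hx.1 hy.1
    obtain ⟨m, hmT, hm⟩ := hT (min x y) hpos (by linarith [hx.2])
    calc (rankDiagram r (b, d) : ℤ) ≤ m := Int.ofNat_le.2 (Nat.sInf_le hmT)
      _ ≤ _ := hm.trans_le (h.boxCount_mono (by linarith) (by linarith) (by linarith)
        (by linarith [hx.2, hy.2]) (by linarith) (by linarith) (by linarith))

lemma exists_forall_eq_add_rankDiagram_top (b : ℝ) :
    ∃ ε₀ > 0, ∃ c₀ > b + ε₀, ∀ x ∈ Set.Ioc 0 ε₀, ∀ c ≥ c₀,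
      r (b + x) c = r (b - x) c + rankDiagram r (b, ⊤) := by
  set T := {m : ℕ | ∃ ε > 0, ∃ c > b + ε, (m : ℤ) = (r (b + ε) c : ℤ) - r (b - ε) c}
  have hT : ∀ ε > 0, ∀ c > b + ε, r (b + ε) c - r (b - ε) c ∈ T := fun ε hε c hc => by
    have := h.mono (show b - ε ≤ b + ε by linarith) (show b + ε ≤ c from hc.le)
    exact ⟨ε, hε, c, hc, by lia⟩
  obtain ⟨ε₀, h₀, c₀, hc₀, hmin⟩ := Nat.sInf_mem ⟨_, hT 1 one_pos (b + 2) (by linarith)⟩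
  refine ⟨ε₀, h₀, c₀, hc₀, fun x ⟨hx, hx'⟩ c hc => ?_⟩
  change _ = _ + sInf T
  have := Nat.sInf_le (hT x hx c (by linarith))
  have := h.mono (show b - x ≤ b + x by linarith) (show b + x ≤ c by linarith)
  have := h.rect (show b - ε₀ ≤ b + ε₀ by linarith) hc₀.le hc
  have := h.mono (show b - ε₀ ≤ b - x by linarith) (show b - x ≤ c by linarith)
  have := h.mono (show b + x ≤ b + ε₀ by linarith) (show b + ε₀ ≤ c by linarith)
  lia

theorem dropAt_riseAt {b : ℝ} {d : WithTop ℝ} (hbd : b < d) :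
    dropAt (fun c => riseAt (fun a => r a c) b) d = rankDiagram r (b, d) := by
  induction d with
  | top =>
    obtain ⟨ε₀, h₀, c₀, -, H⟩ := h.exists_forall_eq_add_rankDiagram_top b
    refine dropAt_top_eq ((Filter.eventually_ge_atTop c₀).mono fun c hc => riseAt_eq ?_)
    filter_upwards [Ioc_mem_nhdsGT h₀] with x hx using H x hx c hc
  | coe d =>
    obtain ⟨ε₀, h₀, hlt, H⟩ := h.exists_forall_boxCount_eq_rankDiagram (WithTop.coe_lt_coe.1 hbd)
    refine dropAt_eq ?_
    filter_upwards [Ioc_mem_nhdsGT h₀] with y hy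
    have hb : b < b + ε₀ := by linarith
    obtain ⟨x, ⟨h₁, h₂⟩, hx⟩ := ((h.eventually_riseAt monotone_id hb (y := d - y)
      (show b + ε₀ ≤ d - y by linarith [hy.2])).and
      (h.eventually_riseAt monotone_id hb (y := d + y)
      (show b + ε₀ ≤ d + y by linarith [hy.1]))).and (Ioc_mem_nhdsGT h₀) |>.exists
    have := H x hx y hy
    simp only [boxCount, id] at *
    lia

theorem riseAt_dropAt {b : ℝ} {d : WithTop ℝ} (hbd : b < d) :
    riseAt (fun a => dropAt (r a) d) b = rankDiagram r (b, d) := by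
  induction d with
  | top =>
    obtain ⟨ε₀, h₀, c₀, -, H⟩ := h.exists_forall_eq_add_rankDiagram_top b
    refine riseAt_eq ?_
    filter_upwards [Ioc_mem_nhdsGT h₀] with x hx
    obtain ⟨c, ⟨h₁, h₂⟩, hc⟩ := ((h.eventually_dropAt_top monotone_id (le_refl (b + x))).and
      (h.eventually_dropAt_top monotone_id (le_refl (b - x)))).and
      (Filter.eventually_ge_atTop c₀) |>.exists
    exact h₁.symm.trans ((H x hx c hc).trans (congrArg (· + _) h₂))
  | coe d =>
    obtain ⟨ε₀, h₀, hlt, H⟩ := h.exists_forall_boxCount_eq_rankDiagram (WithTop.coe_lt_coe.1 hbd)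
    refine riseAt_eq ?_
    filter_upwards [Ioc_mem_nhdsGT h₀] with x hx
    have hd : d - ε₀ < d := by linarith
    obtain ⟨y, ⟨h₁, h₂⟩, hy⟩ := ((h.eventually_dropAt monotone_id hd (x := b - x)
      (show b - x ≤ d - ε₀ by linarith [hx.1])).and
      (h.eventually_dropAt monotone_id hd (x := b + x)
      (show b + x ≤ d - ε₀ by linarith [hx.2]))).and (Ioc_mem_nhdsGT h₀) |>.exists
    have := H x hx y hy
    simp only [boxCount, id] at *
    lia

end IsRankFunction

/-! ### Matching bars with the same birth or the same death -/

namespace IsRankFunction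

section TailCounts

variable {r : ℝ → ℝ → ℕ} (h : IsRankFunction r)
include h

lemma isTailCount_birth (b : ℝ) :
    IsTailCount ((fun p : (rankDiagram r).Points => p.1.1) ⁻¹' {b}) (fun p => p.1.2) (Set.Ioi b)
      (fun c => riseAt (fun a => r a c) b) where
  isOpen := isOpen_Ioi
  isUpperSet := isUpperSet_Ioi b
  nonempty := Set.nonempty_Ioi
  antitoneOn c hc _ _ hcc' := h.riseAt_le_riseAt monotone_id hc le_rfl hcc'
  mem_of_eq := by
    rintro p rfl x hx
    exact WithTop.coe_lt_coe.1 (hx ▸ birth_lt_death p)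
  encard_eq d hd := by
    have hbd : (b : WithTop ℝ) < d := by
      induction d with
      | top => exact WithTop.coe_lt_top b
      | coe d => exact WithTop.coe_lt_coe.2 (hd d rfl)
    rw [h.dropAt_riseAt hbd, ← PersistenceDiagram.encard_setOf_fst_eq]
    congr 1
    ext p
    exact (Prod.ext_iff (x := p.1) (y := (b, d))).symm

lemma isTailCount_death (hzero : ∀ᶠ a in Filter.atBot, ∀ c, r a c = 0) (d : WithTop ℝ) :
    IsTailCount ((fun p : (rankDiagram r).Points => p.1.2) ⁻¹' {d})
      (fun p => ((-p.1.1 : ℝ) : WithTop ℝ)) {x : ℝ | ((-x : ℝ) : WithTop ℝ) < d}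
      (fun x => dropAt (r (-x)) d) where
  isOpen := by
    induction d with
    | top => simp only [WithTop.coe_lt_top, Set.ofPred_true, isOpen_univ]
    | coe d =>
      simp only [WithTop.coe_lt_coe]
      exact isOpen_lt continuous_neg continuous_const
  isUpperSet x y hxy hx := lt_of_le_of_lt (WithTop.coe_le_coe.2 (neg_le_neg hxy)) hx
  nonempty := by
    induction d with
    | top => exact ⟨0, WithTop.coe_lt_top _⟩
    | coe d => exact ⟨1 - d, WithTop.coe_lt_coe.2 (by linarith)⟩
  antitoneOn x hx y _ hxy := h.dropAt_le_dropAt monotone_id hx (neg_le_neg hxy) le_rfl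
  mem_of_eq := by
    rintro p rfl x hx
    obtain rfl := WithTop.coe_injective hx
    simpa only [Set.mem_ofPred_eq, neg_neg] using birth_lt_death p
  encard_eq x hx := by
    induction x with
    | top =>
      rw [dropAt_top_eq (m := 0), Nat.cast_zero, Set.encard_eq_zero]
      · exact Set.eq_empty_of_forall_notMem fun p hp => WithTop.coe_ne_top hp.2
      · refine (Filter.tendsto_neg_atTop_atBot.eventually hzero).mono fun a ha => ?_
        exact (congrArg (dropAt · d) (funext ha)).trans (dropAt_const_zero d)
    | coe x =>
      have hrise := h.riseAt_dropAt (hx x rfl)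
      rw [riseAt_eq_dropAt_neg, neg_neg] at hrise
      rw [hrise, ← PersistenceDiagram.encard_setOf_fst_eq]
      congr 1
      ext p
      simp only [Set.mem_inter_iff, Set.mem_preimage, Set.mem_singleton_iff, WithTop.coe_inj,
        Set.mem_ofPred_eq, Prod.ext_iff, neg_eq_iff_eq_neg]
      exact and_comm

end TailCounts

section Curves

variable {P : Type*} [Preorder P] {R : P → P → ℕ} (hR : IsRankFunction R) {φ χ ψ ψ' : ℝ → P}
include hR

theorem exists_birth_matching (hφ : Monotone φ) (hψ : Monotone ψ) (hψ' : Monotone ψ')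
    (hφψ : ∀ a, φ a ≤ ψ a) (hψψ' : ∀ a, ψ a ≤ ψ' a) {θ : ℝ} (hθ : 0 ≤ θ)
    (hψ'ψ : ∀ a, ψ' a ≤ ψ (a + θ)) :
    ∃ μ : (rankDiagram fun a b => R (φ a) (ψ' b)).Points →
        (rankDiagram fun a b => R (φ a) (ψ b)).Points, Function.Injective μ ∧
      (∀ q, (μ q).1.1 = q.1.1 ∧ q.1.2 ≤ (μ q).1.2 ∧ (μ q).1.2 ≤ q.1.2 + θ) ∧
      ∀ p, ((p.1.1 + θ : ℝ) : WithTop ℝ) < p.1.2 → p ∈ Set.range μ := by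
  obtain ⟨μ, hinj, hμ, hrange⟩ := exists_injective_of_isTailCount
    (hR.comp hφ hψ hφψ).isTailCount_birth
    (hR.comp hφ hψ' fun a => (hφψ a).trans (hψψ' a)).isTailCount_birth
    (σ := id) Function.injective_id (u := 0) (v := θ) (by simpa)
    (fun b c hc => by
      rw [sub_zero]
      exact ⟨hc, hR.riseAt_le_riseAt hφ hc (hφψ c) (hψψ' c)⟩)
    (fun b c hc => hR.riseAt_le_riseAt hφ hc ((hφψ c).trans (hψψ' c)) (hψ'ψ c))
  refine ⟨μ, hinj, fun q => by simpa using hμ q, fun p hp => ?_⟩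
  obtain ⟨x, hx, hxp⟩ := exists_between hp
  lift x to ℝ using hxp.ne_top
  refine hrange p p.1.1 (x - θ) rfl ?_ (by rwa [sub_add_cancel])
  exact lt_sub_iff_add_lt.2 (WithTop.coe_lt_coe.1 hx)

theorem exists_death_matching (hφ : Monotone φ) (hχ : Monotone χ) (hψ : Monotone ψ)
    (hχψ : ∀ a, χ a ≤ ψ a) {η : ℝ} (hη : 0 ≤ η) (hφψ : ∀ a, φ a ≤ ψ (a + η))
    (hφχ : ∀ a, φ a ≤ χ (a + η)) (hχφ : ∀ a, χ a ≤ φ (a + η))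
    (hφ₀ : ∀ᶠ a in Filter.atBot, ∀ y, R (φ a) y = 0)
    (hχ₀ : ∀ᶠ a in Filter.atBot, ∀ y, R (χ a) y = 0) :
    ∃ ν : (rankDiagram fun a b => R (φ a) (ψ (b + η))).Points →
        (rankDiagram fun a b => R (χ a) (ψ b)).Points, Function.Injective ν ∧
      (∀ q, (ν q).1.2 = q.1.2 + η ∧ (ν q).1.1 ≤ q.1.1 + η ∧ q.1.1 ≤ (ν q).1.1 + η) ∧
      ∀ p, ((p.1.1 + 2 * η : ℝ) : WithTop ℝ) < p.1.2 → p ∈ Set.range ν := by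
  have hψη : Monotone fun a => ψ (a + η) := fun _ _ hab => hψ (by gcongr)
  have hdrop : ∀ x d, dropAt (fun c => R x (ψ (c + η))) d = dropAt (fun c => R x (ψ c)) (d + η) :=
    fun x => dropAt_comp_add_right (fun c => R x (ψ c)) η
  have hlt : ∀ (d : WithTop ℝ) (c : ℝ), ((-c : ℝ) : WithTop ℝ) < d →
      ((-c + η : ℝ) : WithTop ℝ) < d + η := fun d c hc => by
    rw [WithTop.coe_add]
    exact WithTop.add_lt_add_right WithTop.coe_ne_top hc
  obtain ⟨ν, hinj, hν, hrange⟩ := exists_injective_of_isTailCount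
    ((hR.comp hχ hψ hχψ).isTailCount_death (hχ₀.mono fun _ h c => h (ψ c)))
    ((hR.comp hφ hψη hφψ).isTailCount_death (hφ₀.mono fun _ h c => h (ψ (c + η))))
    (σ := (· + (η : WithTop ℝ))) (fun d d' hd => WithTop.add_right_cancel WithTop.coe_ne_top hd)
    (u := η) (v := η) (by linarith)
    (fun d c hc => by
      have hneg : -(c - η) = -c + η := by ring
      refine ⟨show ((-(c - η) : ℝ) : WithTop ℝ) < d + η from hneg ▸ hlt d c hc, ?_⟩
      rw [hdrop, hneg]
      exact hR.dropAt_le_dropAt hψ (hlt d c hc) (hφχ _) (hχψ _))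
    (fun d c hc => by
      have hle : χ (-(c + η)) ≤ φ (-c) := by simpa using hχφ (-(c + η))
      rw [hdrop]
      exact hR.dropAt_le_dropAt hψ (hlt d c hc) hle (hφψ _))
  refine ⟨ν, hinj, fun q => ?_, fun p hp => ?_⟩
  · obtain ⟨h₁, h₂, h₃⟩ := hν q
    rw [← WithTop.coe_add, WithTop.coe_le_coe] at h₂ h₃
    exact ⟨h₁, by linarith, by linarith⟩
  · obtain ⟨x, hx, hxp⟩ := exists_between hp
    lift x to ℝ using hxp.ne_top
    have hx := WithTop.coe_lt_coe.1 hx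
    refine hrange p (p.1.2 + (-η : ℝ)) (η - x) ?_ ?_ (WithTop.coe_lt_coe.2 (by linarith))
    · rw [add_assoc, ← WithTop.coe_add, neg_add_cancel, WithTop.coe_zero, add_zero]
    · change ((-(η - x) : ℝ) : WithTop ℝ) < _
      rw [neg_sub, sub_eq_add_neg, WithTop.coe_add]
      exact WithTop.add_lt_add_right WithTop.coe_ne_top hxp

end Curves

end IsRankFunction

namespace PersistenceDiagram

lemma edist_le_ofReal {x y η : ℝ} (hxy : x ≤ y + η) (hyx : y ≤ x + η) :
    edist x y ≤ ENNReal.ofReal η := by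
  rw [edist_dist, Real.dist_eq]
  exact ENNReal.ofReal_le_ofReal (abs_le.2 ⟨by linarith, by linarith⟩)

lemma pointDist_le {b b' η : ℝ} {d d' : WithTop ℝ} (hb : b ≤ b' + η) (hb' : b' ≤ b + η)
    (hd : d ≤ d' + η) (hd' : d' ≤ d + η) : pointDist (b, d) (b', d') ≤ ENNReal.ofReal η := by
  induction d with
  | top =>
    obtain rfl : d' = ⊤ := by simpa using hd
    exact edist_le_ofReal hb hb'
  | coe d =>
    lift d' to ℝ using ne_top_of_le_ne_top (by simp) hd'
    rw [← WithTop.coe_add, WithTop.coe_le_coe] at hd hd'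
    exact max_le (edist_le_ofReal hb hb') (edist_le_ofReal hd hd')

lemma diagonalDist_le {b η : ℝ} {d : WithTop ℝ} (hbd : b ≤ d)
    (hdb : d ≤ (b + 2 * η : ℝ)) : diagonalDist (b, d) ≤ ENNReal.ofReal η := by
  lift d to ℝ using ne_top_of_le_ne_top WithTop.coe_ne_top hdb
  rw [WithTop.coe_le_coe] at hbd hdb
  refine ENNReal.div_le_of_le_mul ((edist_le_ofReal (η := 2 * η) (by linarith) hdb).trans_eq ?_)
  rw [mul_comm, ENNReal.ofReal_mul' zero_le_two, ENNReal.ofReal_ofNat]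

end PersistenceDiagram

/-- The ranks `R (φ a) (χ (b + η))` describe the image of the first module in the second one shifted
by `η`. Passing from the first module to this image moves only deaths, passing from the image to the
second module moves only births. -/
theorem IsRankFunction.exists_isMatching {P : Type*} [Preorder P] {R : P → P → ℕ}
    (hR : IsRankFunction R) {φ χ : ℝ → P} (hφ : Monotone φ) (hχ : Monotone χ) {η : ℝ} (hη : 0 ≤ η)
    (hφχ : ∀ a, φ a ≤ χ (a + η)) (hχφ : ∀ a, χ a ≤ φ (a + η))
    (hφ₀ : ∀ᶠ a in Filter.atBot, ∀ y, R (φ a) y = 0)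
    (hχ₀ : ∀ᶠ a in Filter.atBot, ∀ y, R (χ a) y = 0) :
    ∃ M, PersistenceDiagram.IsMatching (rankDiagram fun a b => R (φ a) (φ b))
      (rankDiagram fun a b => R (χ a) (χ b)) (ENNReal.ofReal η) M := by
  obtain ⟨μ, hμ_inj, hμ, hμ_range⟩ := hR.exists_birth_matching hφ hφ
    (ψ' := fun a => χ (a + η)) (fun _ _ hab => hχ (by gcongr)) (fun _ => le_rfl) hφχ
    (θ := 2 * η) (by linarith) fun a => (hχφ (a + η)).trans (hφ (by linarith))
  obtain ⟨ν, hν_inj, hν, hν_range⟩ :=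
    hR.exists_death_matching hφ hχ hχ (fun _ => le_rfl) hη hφχ hφχ hχφ hφ₀ hχ₀
  refine ⟨fun p p' => ∃ q, μ q = p ∧ ν q = p', ?_, ?_, ?_, fun p hp => ?_, fun p hp => ?_⟩
  · rintro _ _ _ ⟨q, rfl, rfl⟩ ⟨q', rfl, hq'⟩
    rw [hν_inj hq']
  · rintro _ _ _ ⟨q, rfl, rfl⟩ ⟨q', hq', rfl⟩
    rw [hμ_inj hq']
  · rintro _ _ ⟨q, rfl, rfl⟩
    obtain ⟨hb, hd, hd'⟩ := hμ q
    obtain ⟨hd'', hb', hb''⟩ := hν q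
    refine PersistenceDiagram.pointDist_le (hb ▸ hb'') (hb ▸ hb') ?_ ?_
    · rw [hd'', add_assoc, ← WithTop.coe_add, ← two_mul]
      exact hd'
    · rw [hd'']
      gcongr
  · refine PersistenceDiagram.diagonalDist_le (birth_lt_death p).le (not_lt.1 fun hlt => ?_)
    obtain ⟨q, rfl⟩ := hμ_range p hlt
    exact hp _ ⟨q, rfl, rfl⟩
  · refine PersistenceDiagram.diagonalDist_le (birth_lt_death p).le (not_lt.1 fun hlt => ?_)
    obtain ⟨q, rfl⟩ := hν_range p hlt
    exact hp _ ⟨q, rfl, rfl⟩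

/-! ### Towers over a category on which homology is thin -/

lemma finrank_range_comp_add_le {K M' M N P : Type*} [DivisionRing K] [AddCommGroup M']
    [Module K M'] [AddCommGroup M] [Module K M] [AddCommGroup N] [Module K N] [AddCommGroup P]
    [Module K P] [Module.Finite K N] (f : M' →ₗ[K] M) (g : M →ₗ[K] N) (h : N →ₗ[K] P) :
    Module.finrank K (h ∘ₗ g).range + Module.finrank K (g ∘ₗ f).range ≤
      Module.finrank K g.range + Module.finrank K (h ∘ₗ g ∘ₗ f).range := by
  have finrank_map_add (A : Submodule K N) : Module.finrank K (A.map h) +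
      Module.finrank K (h.ker ⊓ A : Submodule K N) = Module.finrank K A := by
    have := (h.domRestrict A).finrank_range_add_finrank_ker
    rw [LinearMap.range_domRestrict, LinearMap.ker_domRestrict] at this
    rw [← this, ← Submodule.finrank_map_subtype_eq A, Submodule.map_comap_subtype, inf_comm]
  have hg := finrank_map_add g.range
  have hgf := finrank_map_add (g ∘ₗ f).range
  have hker : Module.finrank K (h.ker ⊓ (g ∘ₗ f).range : Submodule K N) ≤
      Module.finrank K (h.ker ⊓ g.range : Submodule K N) :=
    Submodule.finrank_mono (inf_le_inf_left _ (LinearMap.range_comp_le_range f g))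
  rw [LinearMap.range_comp g h, LinearMap.range_comp (g ∘ₗ f) h]
  lia

section HomRank

variable {𝕜 : Type w} [Field 𝕜] {C : Type u} [Category.{v} C] (H : C ⥤ ModuleCat.{t} 𝕜)

open Classical in
/-- The rank of the linear map induced by some morphism `x ⟶ y`, and zero if there is none. It is
meant for functors that do not distinguish parallel morphisms. -/
noncomputable def homRank (x y : C) : ℕ :=
  if h : Nonempty (x ⟶ y) then Module.finrank 𝕜 (H.map h.some).hom.range else 0

/-- The objects of `C` at which `H` is finite dimensional, preordered by the existence of a
morphism. -/
structure FiniteObject where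
  /-- the object of `C` -/
  obj : C
  finite : Module.Finite 𝕜 (H.obj obj)

instance : Preorder (FiniteObject H) where
  le x y := Nonempty (x.obj ⟶ y.obj)
  le_refl x := ⟨𝟙 x.obj⟩
  le_trans _ _ _ := fun ⟨f⟩ ⟨g⟩ => ⟨f ≫ g⟩

variable {H} (hH : ∀ {x y : C} (f g : x ⟶ y), H.map f = H.map g)
include hH

lemma homRank_eq {x y : C} (f : x ⟶ y) : homRank H x y = Module.finrank 𝕜 (H.map f).hom.range := by
  rw [homRank, dif_pos ⟨f⟩, hH _ f]

lemma isRankFunction_homRank :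
    IsRankFunction fun x y : FiniteObject H => homRank H x.obj y.obj where
  mono := by
    rintro x' x y ⟨f⟩ ⟨g⟩
    have := y.finite
    rw [homRank_eq hH g, homRank_eq hH (f ≫ g), H.map_comp, ModuleCat.hom_comp]
    exact Submodule.finrank_mono (LinearMap.range_comp_le_range _ _)
  anti := by
    rintro x y y' ⟨f⟩ ⟨g⟩
    have := y.finite
    rw [homRank_eq hH f, homRank_eq hH (f ≫ g), H.map_comp, ModuleCat.hom_comp,
      LinearMap.range_comp]
    exact Submodule.finrank_map_le _ _
  rect := by
    rintro x' x y y' ⟨f⟩ ⟨g⟩ ⟨h⟩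
    have := y.finite
    rw [homRank_eq hH (f ≫ g), homRank_eq hH (g ≫ h), homRank_eq hH g,
      homRank_eq hH ((f ≫ g) ≫ h), add_comm]
    rw [H.map_comp, H.map_comp, H.map_comp, H.map_comp]
    exact finrank_range_comp_add_le _ _ _

end HomRank

/-- The extension of a rank function to a bottom element standing for the zero module. -/
def extendRank {P : Type*} (R : P → P → ℕ) : WithBot P → WithBot P → ℕ
  | some x, some y => R x y
  | _, _ => 0

lemma IsRankFunction.extendRank {P : Type*} [Preorder P] {R : P → P → ℕ} (hR : IsRankFunction R) :
    IsRankFunction (extendRank R) := by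
  have anti {x y y' : WithBot P} (hxy : x ≤ y) (hyy' : y ≤ y') :
      _root_.extendRank R x y' ≤ _root_.extendRank R x y := by
    induction x with
    | bot => exact zero_le
    | coe x =>
      obtain ⟨y, rfl, hxy⟩ := WithBot.coe_le_iff.1 hxy
      obtain ⟨y', rfl, hyy'⟩ := WithBot.coe_le_iff.1 hyy'
      exact hR.anti ‹x ≤ y› ‹y ≤ y'›
  refine ⟨fun {x' x y} hx hxy => ?_, anti, fun {x' x y y'} hx hxy hyy' => ?_⟩
  · induction x' with
    | bot => exact zero_le
    | coe x' =>
      obtain ⟨x, rfl, hx⟩ := WithBot.coe_le_iff.1 hx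
      obtain ⟨y, rfl, hxy⟩ := WithBot.coe_le_iff.1 hxy
      exact hR.mono ‹x' ≤ x› ‹x ≤ y›
  · induction x' with
    | bot => exact (zero_add _).trans_le (anti hxy hyy')
    | coe x' =>
      obtain ⟨x, rfl, hx⟩ := WithBot.coe_le_iff.1 hx
      obtain ⟨y, rfl, hxy⟩ := WithBot.coe_le_iff.1 hxy
      obtain ⟨y', rfl, hyy'⟩ := WithBot.coe_le_iff.1 hyy'
      exact hR.rect ‹x' ≤ x› ‹x ≤ y› ‹y ≤ y'›

namespace Tower

variable {𝕜 : Type w} [Field 𝕜]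

lemma persistenceDiagram_eq_rankDiagram (V : Tower (ModuleCat.{t} 𝕜)) :
    V.persistenceDiagram = rankDiagram V.rank := by
  funext ⟨b, d⟩
  cases d <;> rfl

variable {C : Type u} [Category.{v} C] {H : C ⥤ ModuleCat.{t} 𝕜}

open Classical in
/-- A tower as a curve of objects indexed by all real numbers; below the resolution it sits at the
bottom element, which stands for the zero module. -/
noncomputable def curve (S : Tower C) (hS : ∀ a, Module.Finite 𝕜 (H.obj (S.functor.obj a)))
    (a : ℝ) : WithBot (FiniteObject H) :=
  if h : S.res ≤ a then some ⟨S.functor.obj ⟨a, h⟩, hS _⟩ else ⊥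

variable {S T : Tower C} {hS : ∀ a, Module.Finite 𝕜 (H.obj (S.functor.obj a))}
  {hT : ∀ a, Module.Finite 𝕜 (H.obj (T.functor.obj a))}

lemma curve_eq_bot {a : ℝ} (ha : a < S.res) : S.curve hS a = ⊥ := dif_neg ha.not_ge

lemma curve_eq_coe {a : ℝ} (ha : S.res ≤ a) :
    S.curve hS a = (⟨S.functor.obj ⟨a, ha⟩, hS _⟩ : FiniteObject H) := dif_pos ha

lemma curve_le_curve {a b : ℝ} (hab : S.res ≤ a → T.res ≤ b)
    (f : ∀ (ha : S.res ≤ a) (hb : T.res ≤ b),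
      Nonempty (S.functor.obj ⟨a, ha⟩ ⟶ T.functor.obj ⟨b, hb⟩)) :
    S.curve hS a ≤ T.curve hT b := by
  by_cases ha : S.res ≤ a
  · rw [curve_eq_coe ha, curve_eq_coe (hab ha)]
    exact WithBot.coe_le_coe.2 (f ha (hab ha))
  · exact (curve_eq_bot (not_le.1 ha)).trans_le bot_le

lemma monotone_curve : Monotone (S.curve hS) := fun _ _ hab =>
  curve_le_curve (fun ha => ha.trans hab) fun _ _ => ⟨S.functor.map (homOfLE hab)⟩

variable (hH : ∀ {x y : C} (f g : x ⟶ y), H.map f = H.map g)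
include hH

lemma persistenceDiagram_map_eq_rankDiagram : (S.map H).persistenceDiagram = rankDiagram fun a b =>
    extendRank (fun x y => homRank H x.obj y.obj) (S.curve hS a) (S.curve hS b) := by
  rw [persistenceDiagram_eq_rankDiagram]
  refine rankDiagram_congr fun a b hab => ?_
  by_cases ha : S.res ≤ a
  · rw [curve_eq_coe ha, curve_eq_coe (ha.trans hab)]
    exact (dif_pos ⟨ha, hab⟩).trans (homRank_eq hH (S.functor.map (homOfLE hab))).symm
  · rw [curve_eq_bot (not_le.1 ha)]
    exact dif_neg fun h => ha h.1

/-- As `H` does not distinguish parallel morphisms, interleaving morphisms need not satisfy any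
compatibility. -/
theorem bottleneckDist_map_le (hS : ∀ a, Module.Finite 𝕜 (H.obj (S.functor.obj a)))
    (hT : ∀ a, Module.Finite 𝕜 (H.obj (T.functor.obj a))) {η : ℝ} (hη : 0 ≤ η)
    (hres : T.res ≤ S.res + η) (hres' : S.res ≤ T.res + η)
    (hST : ∀ a b, a.1 + η ≤ b.1 → Nonempty (S.functor.obj a ⟶ T.functor.obj b))
    (hTS : ∀ a b, a.1 + η ≤ b.1 → Nonempty (T.functor.obj a ⟶ S.functor.obj b)) :
    PersistenceDiagram.bottleneckDist (S.map H).persistenceDiagram (T.map H).persistenceDiagram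
      ≤ ENNReal.ofReal η := by
  rw [persistenceDiagram_map_eq_rankDiagram hH (hS := hS),
    persistenceDiagram_map_eq_rankDiagram hH (hS := hT)]
  refine sInf_le ((isRankFunction_homRank hH).extendRank.exists_isMatching monotone_curve
    monotone_curve hη ?_ ?_ ?_ ?_)
  · exact fun a => curve_le_curve (fun _ => by linarith) fun ha hb => hST ⟨a, ha⟩ ⟨_, hb⟩ le_rfl
  · exact fun a => curve_le_curve (fun _ => by linarith) fun ha hb => hTS ⟨a, ha⟩ ⟨_, hb⟩ le_rfl
  · filter_upwards [Filter.eventually_lt_atBot S.res] with a ha y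
    rw [curve_eq_bot ha]
    rfl
  · filter_upwards [Filter.eventually_lt_atBot T.res] with a ha y
    rw [curve_eq_bot ha]
    rfl

end Tower

/-! ### Homology of nerves -/

namespace SimplicialComplex

open Classical in
/-- Two simplicial maps are contiguous if the images of every face lie in a common face. -/
def Contiguous {K L : SimplicialComplex.{v}} (φ ψ : K ⟶ L) : Prop :=
  ∀ σ ∈ K.complex, σ.image φ.toFun ∪ σ.image ψ.toFun ∈ L.complex

namespace Contiguous

variable {K L : SimplicialComplex.{v}} {φ ψ : K ⟶ L} (h : Contiguous φ ψ)
include h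

open Classical in
open Simplicial in
/-- The simplicial homotopy between contiguous maps: on `K × Δ[1]` it is `φ` on the vertices over
`0` and `ψ` on those over `1`. -/
noncomputable def homotopy : SSet.Homotopy (toSSet.map φ) (toSSet.map ψ) where
  h :=
    { app := fun n => ↾fun x =>
        ⟨fun i => if (SSet.stdSimplex.objEquiv x.2).toOrderHom i = 0 then φ.toFun (x.1.1 i)
            else ψ.toFun (x.1.1 i), by
          refine (L.complex.isRelLowerSet_faces (h _ x.1.2)).2
            (Finset.image_subset_iff.2 fun i hi => ?_) (Finset.univ_nonempty.image _)
          have hi := Finset.mem_image_of_mem x.1.1 hi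
          split_ifs
          · exact Finset.mem_union_left _ (Finset.mem_image_of_mem _ hi)
          · exact Finset.mem_union_right _ (Finset.mem_image_of_mem _ hi)⟩
      naturality := fun m n θ => rfl }
  h₀ := by
    ext n x
    rfl
  h₁ := by
    ext n x
    rfl
  rel := by ext _ ⟨⟨_, ⟨⟩⟩, _⟩

lemma homology_map_eq (𝕜 : Type w) [Field 𝕜] (k : ℕ) :
    (homology 𝕜 k).map φ = (homology 𝕜 k).map ψ :=
  SSet.Homotopy.congr_homologyMap h.homotopy _ k

end Contiguous

end SimplicialComplex

lemma Cover.contiguous_nerve_map {X : Type u} {U V : Cover.{u, v} X} (ξ ζ : U ⟶ V) :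
    SimplicialComplex.Contiguous (nerve.map ξ) (nerve.map ζ) := by
  classical
  rintro σ ⟨hσ, x, hx⟩
  refine ⟨(hσ.image _).mono Finset.subset_union_left, x, ?_⟩
  rw [Set.mem_iInter₂] at hx ⊢
  intro j hj
  obtain hj | hj := Finset.mem_union.1 hj <;> obtain ⟨i, hi, rfl⟩ := Finset.mem_image.1 hj
  · exact ξ.subset i (hx i hi)
  · exact ζ.subset i (hx i hi)

section Finiteness

open Limits in
lemma finite_of_isColimit_cofan {R : Type u} [Ring R] {ι : Type w} [Finite ι]
    {M : ι → ModuleCat.{v} R} [∀ i, Module.Finite R (M i)] {c : Cofan M} (hc : IsColimit c) :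
    Module.Finite R c.pt := by
  have iSup_range : (⨆ i, (c.inj i).hom.range) = ⊤ := by
    set N := ⨆ i, (c.inj i).hom.range
    rw [← N.ker_mkQ, LinearMap.ker_eq_top]
    have : ModuleCat.ofHom N.mkQ = 0 := hc.hom_ext fun ⟨i⟩ => by
      ext x
      exact (Submodule.Quotient.mk_eq_zero N).2
        (Submodule.mem_iSup_of_mem i (LinearMap.mem_range_self (c.inj i).hom x))
    exact congrArg ModuleCat.Hom.hom this
  refine ⟨iSup_range ▸ Submodule.fg_iSup _ fun i => ?_⟩
  rw [LinearMap.range_eq_map]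
  exact Module.Finite.fg_top.map _

lemma finite_sset_homology {R : Type w} [Ring R] [IsNoetherianRing R] (X : SSet.{v})
    [∀ n, Finite (X.obj n)] (M : ModuleCat.{max v w} R) [Module.Finite R M] (n : ℕ) :
    Module.Finite R (SSet.homology (C := ModuleCat.{max v w} R) X M n) := by
  have : Module.Finite R ((X.chainComplex M).X n) :=
    finite_of_isColimit_cofan (X.isColimitChainComplexXCofan M n)
  have : Module.Finite R ((X.chainComplex M).cycles n) :=
    Module.Finite.of_injective ((X.chainComplex M).iCycles n).hom
      ((ModuleCat.mono_iff_injective _).1 inferInstance)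
  exact Module.Finite.of_surjective ((X.chainComplex M).homologyπ n).hom
    ((ModuleCat.epi_iff_surjective _).1 inferInstance)

lemma SimplicialComplex.finite_homology (K : SimplicialComplex.{v}) [Finite K.V] (𝕜 : Type w)
    [Field 𝕜] (k : ℕ) : Module.Finite 𝕜 ((homology 𝕜 k).obj K) := by
  have (n : SimplexCategoryᵒᵖ) : Finite ((toSSet.obj K).obj n) := Subtype.finite
  exact finite_sset_homology _ _ _

end Finiteness

/-! ### Good towers of covers -/

lemma min_diam_univ_le_diam_cthickening {Z : Type*} [PseudoMetricSpace Z] [PreconnectedSpace Z]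
    {U : Set Z} (hU : U.Nonempty) (m : ℝ) :
    min m (Metric.diam (Set.univ : Set Z)) ≤ Metric.diam (Metric.cthickening m U) := by
  by_cases hZ : Bornology.IsBounded (Set.univ : Set Z)
  swap
  · rw [Metric.diam_eq_zero_of_unbounded hZ]
    exact (min_le_right m 0).trans Metric.diam_nonneg
  obtain hm | hm := le_total m 0
  · exact (min_le_left _ _).trans (hm.trans Metric.diam_nonneg)
  obtain ⟨x, hx⟩ := hU
  by_cases hfar : ∃ y, m ≤ dist y x
  · obtain ⟨y, hy⟩ := hfar
    obtain ⟨z, hz⟩ : m ∈ Set.range fun z => dist z x :=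
      (isPreconnected_range (continuous_id.dist continuous_const)).Icc_subset
        ⟨x, dist_self x⟩ ⟨y, rfl⟩ ⟨hm, hy⟩
    calc min m _ ≤ m := min_le_left _ _
      _ = dist z x := hz.symm
      _ ≤ _ := Metric.dist_le_diam_of_mem (hZ.subset (Set.subset_univ _))
        (Metric.mem_cthickening_of_dist_le z x m U hx hz.le) (Metric.self_subset_cthickening U hx)
  · have : Metric.cthickening m U = Set.univ := Set.eq_univ_of_forall fun y =>
      Metric.mem_cthickening_of_dist_le y x m U hx (not_le.1 fun hy => hfar ⟨y, hy⟩).le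
    exact this ▸ min_le_right _ _

lemma mul_exp_add_le_exp_add_log {c m a t : ℝ} (hc : 0 < c) (hm : 0 ≤ m) (ht : 0 ≤ t)
    (hat : -a ≤ t) :
    c * (Real.exp a + 2 * m) ≤ Real.exp (a + (Real.log (2 * c * m + c) + t)) := by
  have hexp : Real.exp a ≤ Real.exp (a + t) := Real.exp_le_exp.2 (by linarith)
  have hone : 1 ≤ Real.exp (a + t) := Real.one_le_exp (by linarith)
  calc c * (Real.exp a + 2 * m) = c * Real.exp a + 2 * c * m * 1 := by ring
    _ ≤ c * Real.exp (a + t) + 2 * c * m * Real.exp (a + t) := by gcongr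
    _ = (2 * c * m + c) * Real.exp (a + t) := by ring
    _ = Real.exp (a + (Real.log (2 * c * m + c) + t)) := by
      rw [add_left_comm, Real.exp_add (Real.log _), Real.exp_log (by positivity)]

lemma Cover.finite_pullback {X : Type u} [TopologicalSpace X] {Z : Type w} [TopologicalSpace Z]
    {U : Cover.{w, v} Z} (hU : U.IsFinitePathConnectedOpen) {f : X → Z} (hf : IsWellBehaved f) :
    Finite ((pullback f).obj U).ι := by
  have := hU.finite
  have (i : U.ι) : Finite (ZerothHomotopy (f ⁻¹' U.set i)) :=
    hf _ (hU.isOpen i) (hU.isPathConnected i)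
  exact Finite.instSigma

lemma Cover.nonempty_pullback_hom {X : Type u} [TopologicalSpace X] {Z : Type w}
    {U V : Cover.{w, v} Z} {f g : X → Z} (h : ∀ i, ∃ j, f ⁻¹' U.set i ⊆ g ⁻¹' V.set j) :
    Nonempty ((pullback f).obj U ⟶ (pullback g).obj V) := by
  choose ξ hξ using h
  exact ⟨{ toFun := fun p => ⟨ξ p.1, componentMap (hξ p.1) p.2⟩
           subset := fun _ => componentSet_subset _ _ }⟩

namespace IsGoodTower

variable {Z : Type v} [MetricSpace Z] {c s : ℝ} {W : Tower (Cover.{v, w} Z)}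
  (hW : IsGoodTower c s W)
include hW

lemma finite_homology_pullback {X : Type u} [TopologicalSpace X] {f : X → Z} (hf : IsWellBehaved f)
    (𝕜 : Type t) [Field 𝕜] (k : ℕ) (a : Set.Ici W.res) :
    Module.Finite 𝕜 ((Cover.nerve ⋙ SimplicialComplex.homology 𝕜 k).obj
      ((Cover.pullback f).obj (W.functor.obj a))) := by
  have : Finite (Cover.nerve.obj ((Cover.pullback f).obj (W.functor.obj a))).V :=
    Cover.finite_pullback (hW.isFinitePathConnectedOpen a) hf
  exact SimplicialComplex.finite_homology _ 𝕜 k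

variable [PreconnectedSpace Z] {m : ℝ} (hsm : s ≤ m)
include hsm

lemma exists_cthickening_subset (a b : Set.Ici W.res) (hab : c * (a.1 + 2 * m) ≤ b.1)
    (i : (W.functor.obj a).ι) :
    ∃ j, Metric.cthickening m ((W.functor.obj a).set i) ⊆ (W.functor.obj b).set j := by
  set U := (W.functor.obj a).set i
  have hc := zero_le_one.trans hW.one_le
  have hU : U.Nonempty := ((hW.isFinitePathConnectedOpen a).isPathConnected i).nonempty
  obtain ⟨h, j, hj⟩ := hW.exists_superset (Metric.cthickening m U)
    ((le_min hsm hW.le_diam).trans (min_diam_univ_le_diam_cthickening hU m))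
  have hle : c * Metric.diam (Metric.cthickening m U) ≤ b.1 := by
    refine (mul_le_mul_of_nonneg_left ?_ hc).trans hab
    linarith [Metric.diam_cthickening_le U (hW.pos.le.trans hsm), hW.diam_le a i]
  let w := W.functor.map (homOfLE (show (⟨_, h⟩ : Set.Ici W.res) ≤ b from hle))
  exact ⟨w.toFun j, hj.trans (w.subset j)⟩

lemma nonempty_pullback_hom {X : Type u} [TopologicalSpace X] {f g : X → Z}
    (hfg : ∀ x, dist (f x) (g x) ≤ m) (a b : Set.Ici W.res) (hab : c * (a.1 + 2 * m) ≤ b.1) :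
    Nonempty ((Cover.pullback f).obj (W.functor.obj a) ⟶
      (Cover.pullback g).obj (W.functor.obj b)) := by
  refine Cover.nonempty_pullback_hom fun i => ?_
  obtain ⟨j, hj⟩ := hW.exists_cthickening_subset hsm a b hab i
  exact ⟨j, fun x hx => hj (Metric.mem_cthickening_of_dist_le _ (f x) _ _ hx
    ((dist_comm _ _).trans_le (hfg x)))⟩

lemma nonempty_logReindex_pullback_hom {X : Type u} [TopologicalSpace X] {f g : X → Z}
    (hfg : ∀ x, dist (f x) (g x) ≤ m) (a b : Set.Ici W.logReindex.res)
    (hab : a.1 + (Real.log (2 * c * m + c) + max 0 (Real.log (1 / s))) ≤ b.1) :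
    Nonempty ((Cover.pullback f).obj (W.logReindex.functor.obj a) ⟶
      (Cover.pullback g).obj (W.logReindex.functor.obj b)) := by
  have ha : Real.log s ≤ a.1 := hW.res_eq ▸ a.2
  have hat : -a.1 ≤ max 0 (Real.log (1 / s)) := by
    rw [one_div, Real.log_inv]
    exact (neg_le_neg ha).trans (le_max_right _ _)
  exact hW.nonempty_pullback_hom hsm hfg _ _
    ((mul_exp_add_le_exp_add_log (zero_lt_one.trans_le hW.one_le) (hW.pos.le.trans hsm)
      (le_max_left _ _) hat).trans (Real.exp_le_exp.2 hab))

end IsGoodTower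

theorem mainTheorem7_general {X : Type u} [TopologicalSpace X]
    {Z : Type v} [MetricSpace Z] [PreconnectedSpace Z]
    (c s δ : ℝ) (W : Tower (Cover.{v, w} Z)) (hW : IsGoodTower c s W)
    (f g : X → Z) (hf : IsWellBehaved f) (hg : IsWellBehaved g)
    (hδ : ∀ x, dist (f x) (g x) ≤ δ) (𝕜 : Type t) [Field 𝕜] (k : ℕ) :
    PersistenceDiagram.bottleneckDist
        ((multiscaleMapper W.logReindex f).diagram 𝕜 k)
        ((multiscaleMapper W.logReindex g).diagram 𝕜 k)
      ≤ ENNReal.ofReal (Real.log (2 * c * max s δ + c) + max 0 (Real.log (1 / s))) := by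
  have hm : s ≤ max s δ := le_max_left s δ
  have hη : 0 ≤ Real.log (2 * c * max s δ + c) + max 0 (Real.log (1 / s)) :=
    add_nonneg (Real.log_nonneg (by nlinarith [hW.one_le, hW.pos])) (le_max_left _ _)
  have hfg : ∀ x, dist (f x) (g x) ≤ max s δ := fun x => (hδ x).trans (le_max_right s δ)
  exact Tower.bottleneckDist_map_le (H := Cover.nerve ⋙ SimplicialComplex.homology 𝕜 k)
    (S := W.logReindex.map (Cover.pullback f)) (T := W.logReindex.map (Cover.pullback g))
    (fun ξ ζ => (Cover.contiguous_nerve_map ξ ζ).homology_map_eq 𝕜 k)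
    (fun _ => hW.finite_homology_pullback hf 𝕜 k _) (fun _ => hW.finite_homology_pullback hg 𝕜 k _)
    hη (le_add_of_nonneg_right hη) (le_add_of_nonneg_right hη)
    (hW.nonempty_logReindex_pullback_hom hm hfg)
    (hW.nonempty_logReindex_pullback_hom hm fun x => (dist_comm _ _).trans_le (hfg x))

theorem mainTheorem7 {X : Type u} [TopologicalSpace X]
    {Z : Type v} [MetricSpace Z] [CompactSpace Z] [ConnectedSpace Z]
    (c s δ : ℝ) (W : Tower (Cover.{v, w} Z)) (hW : IsGoodTower c s W)
    (f g : X → Z) (hf : Continuous f) (hg : Continuous g)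
    (hf' : IsWellBehaved f) (hg' : IsWellBehaved g)
    (hδ : IsLUB (Set.range fun x => dist (f x) (g x)) δ)
    (𝕜 : Type t) [Field 𝕜] (k : ℕ) :
    PersistenceDiagram.bottleneckDist
        ((multiscaleMapper W.logReindex f).diagram 𝕜 k)
        ((multiscaleMapper W.logReindex g).diagram 𝕜 k)
      ≤ ENNReal.ofReal (Real.log (2 * c * max s δ + c) + max 0 (Real.log (1 / s))) :=
  mainTheorem7_general c s δ W hW f g hf' hg' (fun x => hδ.1 (Set.mem_range_self x)) 𝕜 k
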